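/- Let $R$ be a commutative noetherian local ring with maximal ideal $\mathfrak m$, and let $M$ be a nonzero finitely generated $R$-module of grade $g=\min\{i : \operatorname{Ext}^i_R(M,R)\neq 0\}$. Let $F=(\cdots\xrightarrow{d_2}F_1\xrightarrow{d_1}F_0\to 0)$ be a minimal free resolution of $M$ (each $F_n$ is free of finite rank and $d_{n+1}(F_{n+1})\subseteq\mathfrak m F_n$ for all $n\ge 0$). Write $(-)^*=\operatorname{Hom}_R(-,R)$ and, for $n\ge 0$, let $\Omega^nM=\operatorname{Coker}(d_{n+1})$ be the $n$-th syzygy of $M$ (so $\Omega^0M\cong M$). We say that $F$ is *self-dual* if $r=\operatorname{pd}_RM$ is finite and $F$ is isomorphic, as a complex, to $F^*=(0\to F_0^*\xrightarrow{d_1^*}F_1^*\to\cdots\xrightarrow{d_r^*}F_r^*\to 0)$, where $F_j^*$ is placed in homological degree $r-j$. We say that $M$ is *totally self-dual* if $\operatorname{Ext}^g_R(M,R)\cong M$ as $R$-modules and $\operatorname{Ext}^i_R(M,R)=0$ for all $i\neq g$. (1) Suppose that $\operatorname{pd}_RM<\infty$. Then $F$ is self-dual if and only if $M$ is totally self-dual.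 When this is the case, $(\Omega^iM)^*\cong\Omega^{g+1-i}M$ for all integers $0\le i\le g-1$. (2) Suppose that there exist integers $0\le m,n<g$ such that $(\Omega^mM)^*\cong\Omega^nM$. Then $m,n\ge 2$, $g=\operatorname{pd}_RM=m+n-1$, and $F$ is self-dual. -/

import Mathlib

universe u

namespace SelfDualResolution

/-- The module `Ext^i_R(M, R)`. -/
abbrev ExtRing (R : Type u) [CommRing R] (M : Type u) [AddCommGroup M] [Module R M]
    (i : ℕ) : Type u :=
  CategoryTheory.Abelian.Ext (ModuleCat.of R M) (ModuleCat.of R R) i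

/-- The grade of a module: `inf {i | Ext^i_R(M, R) ≠ 0}`, with value `⊤` if there is no such `i`. -/
noncomputable def grade (R : Type u) [CommRing R] (M : Type u) [AddCommGroup M] [Module R M] :
    ℕ∞ :=
  sInf {n : ℕ∞ | ∃ i : ℕ, n = (i : ℕ∞) ∧ Nontrivial (ExtRing R M i)}

/-- The projective dimension of a module. -/
noncomputable abbrev pd (R : Type u) [CommRing R] (M : Type u) [AddCommGroup M] [Module R M] :
    WithBot ℕ∞ :=
  CategoryTheory.projectiveDimension (ModuleCat.of R M)

/-- `M` is totally self-dual: it is nonzero, of some (finite) grade `g`, one has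
`Ext^g_R(M, R) ≅ M` as `R`-modules, and `Ext^i_R(M, R) = 0` for all `i ≠ g`. -/
def IsTotallySelfDual (R : Type u) [CommRing R] (M : Type u) [AddCommGroup M] [Module R M] :
    Prop :=
  Nontrivial M ∧ ∃ g : ℕ, grade R M = (g : ℕ∞) ∧
    Nonempty (ExtRing R M g ≃ₗ[R] M) ∧
    ∀ i : ℕ, i ≠ g → Subsingleton (ExtRing R M i)

section Resolution

variable {R : Type u} [CommRing R]
  {F : ℕ → Type u} [∀ n, AddCommGroup (F n)] [∀ n, Module R (F n)]

/-- `⋯ ⟶ F 2 ⟶ F 1 ⟶ F 0 ⟶ M ⟶ 0`, with differentials `d n : F (n + 1) ⟶ F n` and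
augmentation `ε : F 0 ⟶ M`, is a minimal free resolution of `M` by finitely generated modules
over the local ring `R`: it is exact, all `F n` are free of finite rank, and the image of every
differential lies in `𝔪 F n`. -/
structure IsMinimalFreeResolution [IsLocalRing R] {M : Type u} [AddCommGroup M] [Module R M]
    (d : ∀ n, F (n + 1) →ₗ[R] F n) (ε : F 0 →ₗ[R] M) : Prop where
  free : ∀ n, Module.Free R (F n)
  finite : ∀ n, Module.Finite R (F n)
  surjective : Function.Surjective ε
  exact_zero : Function.Exact (d 0) ε
  exact_succ : ∀ n, Function.Exact (d (n + 1)) (d n)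
  minimal : ∀ n, LinearMap.range (d n) ≤
    IsLocalRing.maximalIdeal R • (⊤ : Submodule R (F n))

/-- The `n`-th syzygy of the resolved module: the cokernel of `F (n + 1) ⟶ F n`. -/
abbrev Syzygy (d : ∀ n, F (n + 1) →ₗ[R] F n) (n : ℕ) : Type u :=
  F n ⧸ LinearMap.range (d n)

/-- The resolution `F` of `M` is self-dual: `r = pd M` is finite and `F` is isomorphic to the
complex `F^* = (0 ⟶ (F 0)^* ⟶ (F 1)^* ⟶ ⋯ ⟶ (F r)^* ⟶ 0)`, which has `(F j)^*` in homological
degree `r - j`, zero modules in the degrees above `r`, and the transposes of the differentials of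
`F` as its differentials. An isomorphism of complexes is a family of linear
isomorphisms `e i j : F i ≅ (F j)^*`, one for each `i + j = r`, that commutes with the
differentials; in the degrees `i > r` the module `F i` is isomorphic to zero. -/
def IsSelfDual (M : Type u) [AddCommGroup M] [Module R M]
    (d : ∀ n, F (n + 1) →ₗ[R] F n) : Prop :=
  ∃ r : ℕ, pd R M = ((r : ℕ∞) : WithBot ℕ∞) ∧
    (∀ i, r < i → Subsingleton (F i)) ∧
    ∃ e : ∀ i j : ℕ, i + j = r → (F i ≃ₗ[R] Module.Dual R (F j)),
      ∀ (i j : ℕ) (h : i + (j + 1) = r) (h' : (i + 1) + j = r) (x : F (i + 1)),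
        e i (j + 1) h (d i x) = (d j).dualMap (e (i + 1) j h' x)

end Resolution

end SelfDualResolution

/-! `Ext^i(M, R)` is the cohomology of `F^*`, and minimality of `F` passes to `F^*`. So where `F^*`
is exact it is a minimal free resolution, and such resolutions are unique up to isomorphism
(`exists_equiv_lift`, iterated in `exists_dual_comparison`).

For (1), self-duality transports the exactness of `F` to `F^*`, leaving only the top cohomology,
which is the cokernel of `d 0`, that is `M`. Conversely, total self-duality makes `F^*` a minimal
resolution of `Ext^g(M, R) ≅ M`, hence isomorphic to `F`.

For (2), put `m = s + 1`. Vanishing of `Ext` below `g` makes `0 → F_0^* → ⋯ → F_s^*` a minimal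
resolution of `(Ω^m M)^* ≅ Ω^n M`, so it agrees with `F` from degree `n` on. Thus `F` has length `n
+ s`. Dualizing this identification shows that `F^*` is exact strictly between degrees `n` and `n +
s` and has top cohomology `M`; since `n < g`, the grade hypothesis covers degrees up to `n`. So `M`
is totally self-dual of grade `n + s = m + n - 1`, and (1) applies. -/

namespace SelfDualResolution

open CategoryTheory CategoryTheory.Abelian

/-! ### `Ext` as cohomology of the dual complex. -/

section ExtOfResolution

variable {R : Type u} [CommRing R] {M : Type u} [AddCommGroup M] [Module R M]
  {F : ℕ → Type u} [∀ n, AddCommGroup (F n)] [∀ n, Module R (F n)]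

/-- The coboundaries in degree `n` of the complex `Hom_R(F, R)`. -/
def coboundaries (d : ∀ n, F (n + 1) →ₗ[R] F n) : ∀ n, Submodule R (Module.Dual R (F n))
  | 0 => ⊥
  | n + 1 => LinearMap.range (d n).dualMap

/-- The cocycles in degree `n` of the complex `Hom_R(F, R)`. -/
def cocycles (d : ∀ n, F (n + 1) →ₗ[R] F n) (n : ℕ) : Submodule R (Module.Dual R (F n)) :=
  LinearMap.ker (d n).dualMap

theorem coboundaries_le_cocycles {d : ∀ n, F (n + 1) →ₗ[R] F n}
    (hd : ∀ n, Function.Exact (d (n + 1)) (d n)) (n : ℕ) : coboundaries d n ≤ cocycles d n := by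
  cases n with
  | zero => exact bot_le
  | succ n =>
    rintro _ ⟨f, rfl⟩
    ext x
    simp [LinearMap.dualMap_apply, (hd n).apply_apply_eq_zero]

/-- The chain complex of modules with the given differentials. -/
noncomputable abbrev moduleComplex (d : ∀ n, F (n + 1) →ₗ[R] F n)
    (hd : ∀ n, Function.Exact (d (n + 1)) (d n)) : ChainComplex (ModuleCat.{u} R) ℕ :=
  ChainComplex.of (fun n => ModuleCat.of R (F n)) (fun n => ModuleCat.ofHom (d n)) fun n => by
    rw [← ModuleCat.ofHom_comp, (hd n).linearMap_comp_eq_zero]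
    rfl

theorem moduleComplex_d (d : ∀ n, F (n + 1) →ₗ[R] F n)
    (hd : ∀ n, Function.Exact (d (n + 1)) (d n)) (n : ℕ) :
    (moduleComplex d hd).d (n + 1) n = ModuleCat.ofHom (d n) :=
  ChainComplex.of_d (fun n => ModuleCat.of R (F n)) (fun n => ModuleCat.ofHom (d n)) n

theorem moduleComplex_exactAt_succ (d : ∀ n, F (n + 1) →ₗ[R] F n)
    (hd : ∀ n, Function.Exact (d (n + 1)) (d n)) (n : ℕ) :
    (moduleComplex d hd).ExactAt (n + 1) := by
  rw [HomologicalComplex.exactAt_iff' _ (n + 1 + 1) (n + 1) n (by simp) (by simp),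
    ShortComplex.moduleCat_exact_iff]
  intro x hx
  change ((moduleComplex d hd).d (n + 1) n).hom x = 0 at hx
  change ∃ y, ((moduleComplex d hd).d (n + 1 + 1) (n + 1)).hom y = x
  rw [moduleComplex_d] at hx ⊢
  exact (hd n x).1 hx

/-- The augmentation of a resolution by modules, as a morphism of complexes. -/
noncomputable def augmentation (d : ∀ n, F (n + 1) →ₗ[R] F n) (ε : F 0 →ₗ[R] M)
    (h0 : Function.Exact (d 0) ε) (hd : ∀ n, Function.Exact (d (n + 1)) (d n)) :
    moduleComplex d hd ⟶ (ChainComplex.single₀ (ModuleCat.{u} R)).obj (ModuleCat.of R M) :=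
  (ChainComplex.toSingle₀Equiv _ _).symm ⟨ModuleCat.ofHom ε, by
    rw [moduleComplex_d, ← ModuleCat.ofHom_comp, h0.linearMap_comp_eq_zero]
    rfl⟩

theorem augmentation_f_zero (d : ∀ n, F (n + 1) →ₗ[R] F n) (ε : F 0 →ₗ[R] M)
    (h0 : Function.Exact (d 0) ε) (hd : ∀ n, Function.Exact (d (n + 1)) (d n)) :
    (augmentation d ε h0 hd).f 0 = ModuleCat.ofHom ε :=
  ChainComplex.toSingle₀Equiv_symm_apply_f_zero _ _

/-- A projective resolution by modules, as a projective resolution in the category of modules. -/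
noncomputable def projectiveResolution (d : ∀ n, F (n + 1) →ₗ[R] F n) (ε : F 0 →ₗ[R] M)
    [∀ n, Module.Projective R (F n)] (hε : Function.Surjective ε)
    (h0 : Function.Exact (d 0) ε) (hd : ∀ n, Function.Exact (d (n + 1)) (d n)) :
    ProjectiveResolution (ModuleCat.of R M) where
  complex := moduleComplex d hd
  projective n := (IsProjective.iff_projective (F n)).1 inferInstance
  π := augmentation d ε h0 hd
  quasiIso := ⟨fun n => by
    cases n with
    | zero =>
      rw [ChainComplex.quasiIsoAt₀_iff, ShortComplex.quasiIso_iff_of_zeros' _ rfl rfl rfl]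
      constructor
      · rw [ShortComplex.moduleCat_exact_iff]
        intro x hx
        change ∃ y, ((moduleComplex d hd).d 1 0).hom y = x
        rw [moduleComplex_d]
        change ((augmentation d ε h0 hd).f 0).hom x = 0 at hx
        rw [augmentation_f_zero] at hx
        exact (h0 x).1 hx
      · change Epi ((augmentation d ε h0 hd).f 0)
        rw [augmentation_f_zero]
        exact (ModuleCat.epi_iff_surjective _).2 hε
    | succ n =>
      rw [quasiIsoAt_iff_exactAt' _ _ (ChainComplex.exactAt_succ_single_obj _ _)]
      exact moduleComplex_exactAt_succ d hd n⟩

variable {d : ∀ n, F (n + 1) →ₗ[R] F n} {ε : F 0 →ₗ[R] M}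

/-- The dual of a cokernel is the kernel of the transpose. -/
noncomputable def dualEquivKerDualMap {A B C : Type*} [AddCommGroup A] [Module R A]
    [AddCommGroup B] [Module R B] [AddCommGroup C] [Module R C] {f : A →ₗ[R] B} {p : B →ₗ[R] C}
    (hfp : Function.Exact f p) (hp : Function.Surjective p) :
    Module.Dual R C ≃ₗ[R] LinearMap.ker f.dualMap :=
  LinearEquiv.ofBijective
    (p.dualMap.codRestrict _ fun k => by
      ext x
      simp [LinearMap.dualMap_apply, hfp.apply_apply_eq_zero]) <| by
    constructor
    · intro k l hkl
      ext x
      obtain ⟨y, rfl⟩ := hp x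
      exact LinearMap.congr_fun (congrArg Subtype.val hkl) y
    · rintro ⟨k, hk⟩
      have hle : LinearMap.range f ≤ LinearMap.ker k := by
        rintro _ ⟨y, rfl⟩
        exact LinearMap.congr_fun hk y
      refine ⟨(LinearMap.range f).liftQ k hle ∘ₗ
        (hfp.linearEquivOfSurjective hp).symm.toLinearMap, ?_⟩
      ext y
      change (LinearMap.range f).liftQ k hle ((hfp.linearEquivOfSurjective hp).symm (p y)) = k y
      have : (hfp.linearEquivOfSurjective hp).symm (p y) = Submodule.Quotient.mk y := by
        rw [LinearEquiv.symm_apply_eq]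
        rfl
      rw [this]
      rfl

/-- Every `Ext`-class is represented by a cocycle; classes of cocycles in positive degree vanish
exactly for coboundaries. -/
theorem exists_cocycle_map [∀ n, Module.Projective R (F n)] (hε : Function.Surjective ε)
    (h0 : Function.Exact (d 0) ε) (hd : ∀ n, Function.Exact (d (n + 1)) (d n))
    (N : Type u) [AddCommGroup N] [Module R N] (n : ℕ) :
    ∃ π : LinearMap.ker (LinearMap.lcomp R N (d n)) →ₗ[R]
        Ext (ModuleCat.of R M) (ModuleCat.of R N) n,
      Function.Surjective π ∧
      ∀ m (h : m + 1 = n) (f), π f = 0 ↔ ∃ k : F m →ₗ[R] N, k ∘ₗ (h ▸ d m) = f.1 := by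
  let P := projectiveResolution d ε hε h0 hd
  have key (f : F n →ₗ[R] N) : P.complex.d (n + 1) n ≫ ModuleCat.ofHom f = 0 ↔ f ∘ₗ d n = 0 := by
    change (moduleComplex d hd).d (n + 1) n ≫ ModuleCat.ofHom f = 0 ↔ _
    rw [moduleComplex_d]
    exact ⟨fun h => congrArg ModuleCat.Hom.hom h, fun h => ModuleCat.hom_ext h⟩
  have hmem (f : LinearMap.ker (LinearMap.lcomp R N (d n))) := (key f.1).2 f.2
  refine ⟨{ toFun f := P.extMk (ModuleCat.ofHom f.1) (n + 1) rfl (hmem f)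
            map_add' f g := (P.add_extMk _ _ _ rfl (hmem f) (hmem g)).symm
            map_smul' r f := ?_ }, ?_, ?_⟩
  · refine Eq.trans ?_ (Ext.smul_eq_comp_mk₀ _ r).symm
    exact (P.extMk_comp_mk₀ (ModuleCat.ofHom f.1) (n + 1) rfl (hmem f)
      (r • 𝟙 (ModuleCat.of R N))).symm
  · intro α
    obtain ⟨f, hf, rfl⟩ := P.extMk_surjective α (n + 1) rfl
    exact ⟨⟨f.hom, (key f.hom).1 hf⟩, rfl⟩
  · rintro m rfl f
    refine (P.extMk_eq_zero_iff _ _ rfl (hmem f) m rfl).trans ?_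
    change (∃ g : ModuleCat.of R (F m) ⟶ _, (moduleComplex d hd).d (m + 1) m ≫ g = _) ↔ _
    rw [moduleComplex_d]
    exact ⟨fun ⟨g, hg⟩ => ⟨g.hom, congrArg ModuleCat.Hom.hom hg⟩,
      fun ⟨k, hk⟩ => ⟨ModuleCat.ofHom k, ModuleCat.hom_ext hk⟩⟩

/-- `Ext^n_R(M, R)` is the cohomology of the dual of a projective resolution of `M`. -/
theorem exists_cocycles_map_extRing [∀ n, Module.Projective R (F n)] (hε : Function.Surjective ε)
    (h0 : Function.Exact (d 0) ε) (hd : ∀ n, Function.Exact (d (n + 1)) (d n)) (n : ℕ) :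
    ∃ π : cocycles d n →ₗ[R] ExtRing R M n, Function.Surjective π ∧
      ∀ f, π f = 0 ↔ f.1 ∈ coboundaries d n := by
  cases n with
  | zero =>
    -- In degree 0 there are no coboundaries, and `Ext^0 = Hom(M, R)` is the kernel of the transpose
    -- of `d 0`.
    let e := (dualEquivKerDualMap h0 hε).symm.trans
      ((ModuleCat.homLinearEquiv (S := R) (M := ModuleCat.of R M)
        (N := ModuleCat.of R R)).symm.trans (Ext.linearEquiv₀ (R := R)).symm)
    refine ⟨e.toLinearMap, e.surjective, fun f => ?_⟩
    exact e.map_eq_zero_iff.trans (Subtype.ext_iff.trans (Submodule.mem_bot R).symm)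
  | succ n =>
    obtain ⟨π, hπ, hker⟩ := exists_cocycle_map hε h0 hd R (n + 1)
    exact ⟨π, hπ, fun f => hker n rfl f⟩

theorem subsingleton_extRing_iff [∀ n, Module.Projective R (F n)] (hε : Function.Surjective ε)
    (h0 : Function.Exact (d 0) ε) (hd : ∀ n, Function.Exact (d (n + 1)) (d n)) (n : ℕ) :
    Subsingleton (ExtRing R M n) ↔ coboundaries d n = cocycles d n := by
  obtain ⟨π, hπ, hker⟩ := exists_cocycles_map_extRing hε h0 hd n
  constructor
  · intro _
    exact le_antisymm (coboundaries_le_cocycles hd n) fun f hf =>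
      (hker ⟨f, hf⟩).1 (Subsingleton.elim _ _)
  · intro h
    refine subsingleton_of_forall_eq 0 fun x => ?_
    obtain ⟨f, rfl⟩ := hπ x
    exact (hker f).2 (h.ge f.2)

end ExtOfResolution

/-! ### Nakayama arguments and projective covers. -/

section Local

variable {R : Type*} [CommRing R]
  {P Q A B : Type*} [AddCommGroup P] [Module R P] [AddCommGroup Q] [Module R Q]
  [AddCommGroup A] [Module R A] [AddCommGroup B] [Module R B]

theorem exists_lift_of_range_le [Module.Projective R P] (f : P →ₗ[R] A) (f' : Q →ₗ[R] A)
    (h : LinearMap.range f ≤ LinearMap.range f') : ∃ a : P →ₗ[R] Q, f' ∘ₗ a = f := by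
  obtain ⟨a, ha⟩ := Module.projective_lifting_property f'.rangeRestrict
    (f.codRestrict (LinearMap.range f') fun x => h ⟨x, rfl⟩) f'.surjective_rangeRestrict
  exact ⟨a, LinearMap.ext fun x => congrArg Subtype.val (LinearMap.congr_fun ha x)⟩

theorem map_ker_of_comp_eq {f : P →ₗ[R] A} {f' : Q →ₗ[R] B} {φ : A ≃ₗ[R] B} {e : P ≃ₗ[R] Q}
    (h : ∀ x, f' (e x) = φ (f x)) :
    (LinearMap.ker f).map e.toLinearMap = LinearMap.ker f' := by
  ext y
  obtain ⟨x, rfl⟩ := e.surjective y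
  simp [h]

theorem map_range_of_comp_eq {f : P →ₗ[R] A} {f' : Q →ₗ[R] B} {e : P ≃ₗ[R] Q} {φ : A ≃ₗ[R] B}
    (h : ∀ x, φ (f x) = f' (e x)) :
    (LinearMap.range f).map φ.toLinearMap = LinearMap.range f' := by
  rw [← LinearMap.range_comp, show φ.toLinearMap ∘ₗ f = f' ∘ₗ e.toLinearMap from LinearMap.ext h,
    LinearMap.range_comp, LinearEquiv.range, Submodule.map_top]

theorem mem_smul_top_dual {I : Ideal R} [Module.Free R P] [Module.Finite R P]
    {ψ : Module.Dual R P} (h : ∀ x, ψ x ∈ I) : ψ ∈ I • (⊤ : Submodule R (Module.Dual R P)) := by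
  rw [← (Module.Free.chooseBasis R P).sum_dual_apply_smul_coord ψ]
  exact sum_mem fun i _ => Submodule.smul_mem_smul (h _) trivial

/-- A matrix with entries in `I` has a transpose with entries in `I`; this is why `F^*` inherits
minimality. -/
theorem range_dualMap_le {I : Ideal R} [Module.Free R P] [Module.Finite R P] {f : P →ₗ[R] Q}
    (h : LinearMap.range f ≤ I • ⊤) :
    LinearMap.range f.dualMap ≤ I • (⊤ : Submodule R (Module.Dual R P)) := by
  rintro _ ⟨ψ, rfl⟩
  refine mem_smul_top_dual fun x => ?_
  have hx := Submodule.mem_map_of_mem (f := ψ) (h ⟨x, rfl⟩)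
  rw [Submodule.map_smul''] at hx
  exact Submodule.smul_le.2 (fun r hr y _ => I.mul_mem_right y hr) hx

variable [IsLocalRing R]

theorem subsingleton_of_top_le_maximalIdeal_smul {N : Type*} [AddCommGroup N] [Module R N]
    [Module.Finite R N] (h : (⊤ : Submodule R N) ≤ IsLocalRing.maximalIdeal R • ⊤) :
    Subsingleton N := by
  rw [← Submodule.subsingleton_iff R, ← subsingleton_iff_bot_eq_top]
  exact (Submodule.eq_bot_of_le_smul_of_le_jacobson_bot _ _ Module.Finite.fg_top h
    (IsLocalRing.maximalIdeal_le_jacobson _)).symm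

/-- `h` is the identity modulo `ker f`, hence modulo `𝔪 P`, and Nakayama applies. -/
theorem surjective_of_comp_eq [Module.Finite R P] {f : P →ₗ[R] A}
    (hf : LinearMap.ker f ≤ IsLocalRing.maximalIdeal R • ⊤) {h : P →ₗ[R] P}
    (hh : f ∘ₗ h = f) : Function.Surjective h := by
  rw [← LinearMap.range_eq_top, eq_top_iff]
  refine Submodule.le_of_le_smul_of_le_jacobson_bot Module.Finite.fg_top
    (IsLocalRing.maximalIdeal_le_jacobson _) fun x _ => ?_
  rw [← add_sub_cancel (h x) x]
  refine add_mem (Submodule.mem_sup_left ⟨x, rfl⟩) (Submodule.mem_sup_right (hf ?_))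
  rw [LinearMap.mem_ker, map_sub, sub_eq_zero]
  exact (LinearMap.congr_fun hh x).symm

/-- Uniqueness of projective covers: two minimal maps from finite projective modules with the same
image differ by an isomorphism. -/
theorem exists_equiv_lift [Module.Finite R P] [Module.Finite R Q] [Module.Projective R P]
    [Module.Projective R Q] (f : P →ₗ[R] A) (f' : Q →ₗ[R] B) (φ : A ≃ₗ[R] B)
    (hrange : (LinearMap.range f).map φ.toLinearMap = LinearMap.range f')
    (hf : LinearMap.ker f ≤ IsLocalRing.maximalIdeal R • ⊤)
    (hf' : LinearMap.ker f' ≤ IsLocalRing.maximalIdeal R • ⊤) :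
    ∃ e : P ≃ₗ[R] Q, ∀ x, f' (e x) = φ (f x) := by
  obtain ⟨a, ha⟩ := exists_lift_of_range_le (φ.toLinearMap ∘ₗ f) f'
    (by rw [LinearMap.range_comp, hrange])
  obtain ⟨b, hb⟩ := exists_lift_of_range_le f' (φ.toLinearMap ∘ₗ f)
    (by rw [LinearMap.range_comp, hrange])
  have hker : LinearMap.ker (φ.toLinearMap ∘ₗ f) ≤ IsLocalRing.maximalIdeal R • ⊤ := by
    rwa [LinearEquiv.ker_comp]
  -- Both composites lie over the identity, so both are surjective; a surjective endomorphism of a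
  -- finite module is injective.
  have hba : Function.Surjective (b ∘ₗ a) :=
    surjective_of_comp_eq hker (by rw [← LinearMap.comp_assoc, hb, ha])
  have hab : Function.Surjective (a ∘ₗ b) :=
    surjective_of_comp_eq hf' (by rw [← LinearMap.comp_assoc, ha, hb])
  have hinj := OrzechProperty.injective_of_surjective_endomorphism _ hba
  exact ⟨LinearEquiv.ofBijective a
    ⟨Function.Injective.of_comp (f := b) hinj, Function.Surjective.of_comp (g := b) hab⟩,
    LinearMap.congr_fun ha⟩

end Local

/-! ### Projective dimension as the length of the minimal resolution. -/

section ProjectiveDimension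

variable {R : Type u} [CommRing R] [IsLocalRing R] {M : Type u} [AddCommGroup M] [Module R M]
  {F : ℕ → Type u} [∀ n, AddCommGroup (F n)] [∀ n, Module R (F n)]
  {d : ∀ n, F (n + 1) →ₗ[R] F n} {ε : F 0 →ₗ[R] M}

theorem IsMinimalFreeResolution.ker_augmentation_le (hF : IsMinimalFreeResolution d ε) :
    LinearMap.ker ε ≤ IsLocalRing.maximalIdeal R • ⊤ :=
  hF.exact_zero.linearMap_ker_eq.trans_le (hF.minimal 0)

theorem IsMinimalFreeResolution.ker_le (hF : IsMinimalFreeResolution d ε) (n : ℕ) :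
    LinearMap.ker (d n) ≤ IsLocalRing.maximalIdeal R • ⊤ :=
  (hF.exact_succ n).linearMap_ker_eq.trans_le (hF.minimal (n + 1))

theorem IsMinimalFreeResolution.shift (hF : IsMinimalFreeResolution d ε) (n : ℕ) :
    IsMinimalFreeResolution (F := fun i => F (n + i)) (fun i => d (n + i))
      (LinearMap.range (d n)).mkQ where
  free i := hF.free (n + i)
  finite i := hF.finite (n + i)
  surjective := Submodule.mkQ_surjective _
  exact_zero := LinearMap.exact_iff.2 (Submodule.ker_mkQ _)
  exact_succ i := hF.exact_succ (n + i)
  minimal i := hF.minimal (n + i)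

theorem IsMinimalFreeResolution.nontrivial_zero [Nontrivial M]
    (hF : IsMinimalFreeResolution d ε) : Nontrivial (F 0) :=
  hF.surjective.nontrivial

theorem IsMinimalFreeResolution.subsingleton_of_range_eq_top (hF : IsMinimalFreeResolution d ε)
    {n : ℕ} (h : LinearMap.range (d n) = ⊤) : Subsingleton (F n) := by
  have := hF.finite n
  exact subsingleton_of_top_le_maximalIdeal_smul (h.symm.trans_le (hF.minimal n))

theorem IsMinimalFreeResolution.subsingleton_of_ge (hF : IsMinimalFreeResolution d ε)
    {n i : ℕ} (hi : n ≤ i) (h : Subsingleton (F n)) : Subsingleton (F i) := by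
  induction i, hi using Nat.le_induction with
  | base => exact h
  | succ i _ ih =>
    refine hF.subsingleton_of_range_eq_top (eq_top_iff.2 fun x _ => ?_)
    exact (hF.exact_succ i x).1 (Subsingleton.elim _ _)

theorem IsMinimalFreeResolution.hasProjectiveDimensionLT_iff (hF : IsMinimalFreeResolution d ε)
    {n : ℕ} : HasProjectiveDimensionLT (ModuleCat.of R M) (n + 1) ↔ Subsingleton (F (n + 1)) := by
  have := hF.free
  constructor
  · intro h
    -- The projection onto `N` is a cocycle. As `Ext^{n+1}(M, N) = 0`, it factors through `d n`,
    -- whose image lies in `𝔪 F n`; hence `N = 𝔪 N` and `N = 0`.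
    let N := F (n + 1) ⧸ LinearMap.range (d (n + 1))
    have := hF.finite (n + 1)
    obtain ⟨π, -, hπ⟩ := exists_cocycle_map hF.surjective hF.exact_zero hF.exact_succ N (n + 1)
    obtain ⟨k, hk⟩ := (hπ n rfl ⟨(LinearMap.range (d (n + 1))).mkQ, LinearMap.range_mkQ_comp _⟩).1
      (Ext.eq_zero_of_hasProjectiveDimensionLT _ (n + 1) le_rfl)
    have hN : Subsingleton N := by
      refine subsingleton_of_top_le_maximalIdeal_smul (R := R) fun y _ => ?_
      obtain ⟨x, rfl⟩ := Submodule.mkQ_surjective _ y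
      have hx := Submodule.mem_map_of_mem (f := k) (hF.minimal n ⟨x, rfl⟩)
      rw [Submodule.map_smul''] at hx
      rw [← LinearMap.congr_fun hk x]
      exact Submodule.smul_mono le_rfl le_top hx
    exact hF.subsingleton_of_range_eq_top (Submodule.Quotient.subsingleton_iff.1 hN)
  · intro h
    rw [CategoryTheory.hasProjectiveDimensionLT_iff.{u}]
    intro i hi Y α
    have := hF.subsingleton_of_ge hi h
    obtain ⟨π, hπ, -⟩ := exists_cocycle_map hF.surjective hF.exact_zero hF.exact_succ Y i
    obtain ⟨f, rfl⟩ := hπ α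
    rw [Subsingleton.elim f 0, map_zero]

theorem IsMinimalFreeResolution.pd_eq [Nontrivial M] (hF : IsMinimalFreeResolution d ε) {r : ℕ}
    (hr : Nontrivial (F r)) (hr' : Subsingleton (F (r + 1))) :
    pd R M = ((r : ℕ∞) : WithBot ℕ∞) := by
  refine le_antisymm ((projectiveDimension_le_iff _ r).2 (hF.hasProjectiveDimensionLT_iff.2 hr'))
    ((projectiveDimension_ge_iff _ r).2 fun h => ?_)
  cases r with
  | zero =>
    exact not_subsingleton M (ModuleCat.subsingleton_of_isZero
      (isZero_of_hasProjectiveDimensionLT_zero (ModuleCat.of R M)))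
  | succ r => exact not_subsingleton _ (hF.hasProjectiveDimensionLT_iff.1 h)

theorem IsMinimalFreeResolution.exists_length [Nontrivial M] (hF : IsMinimalFreeResolution d ε)
    (h : pd R M ≠ ⊤) : ∃ r : ℕ, Nontrivial (F r) ∧ Subsingleton (F (r + 1)) := by
  classical
  obtain ⟨n, hn⟩ := (projectiveDimension_ne_top_iff _).1 h
  have hex : ∃ n, Subsingleton (F (n + 1)) := ⟨n, hF.hasProjectiveDimensionLT_iff.1 hn⟩
  refine ⟨Nat.find hex, ?_, Nat.find_spec hex⟩
  rcases hr : Nat.find hex with _ | r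
  · exact hF.nontrivial_zero
  · exact not_subsingleton_iff_nontrivial.1 (Nat.find_min hex (hr ▸ r.lt_succ_self))

end ProjectiveDimension

/-! ### Comparing resolutions with dual complexes. -/

section Comparison

variable {R : Type u} [CommRing R]
  {F : ℕ → Type u} [∀ n, AddCommGroup (F n)] [∀ n, Module R (F n)]
  {d : ∀ n, F (n + 1) →ₗ[R] F n}
  {G : ℕ → Type u} [∀ n, AddCommGroup (G n)] [∀ n, Module R (G n)]
  {dG : ∀ n, G (n + 1) →ₗ[R] G n}

theorem IsMinimalFreeResolution.coboundaries_le [IsLocalRing R] {M : Type u} [AddCommGroup M]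
    [Module R M] {ε : F 0 →ₗ[R] M} (hF : IsMinimalFreeResolution d ε) (n : ℕ) :
    coboundaries d n ≤ IsLocalRing.maximalIdeal R • ⊤ := by
  cases n with
  | zero => exact bot_le
  | succ n =>
    have := hF.free
    have := hF.finite
    exact range_dualMap_le (hF.minimal n)

/-- If the dual of a minimal free resolution `F` is acyclic in degrees below `s`, then an
isomorphism `G 0 ≃ (F s)^*` that matches the images of the differentials extends to an isomorphism
of the minimal free resolution `G` with `(F s)^* ← ⋯ ← (F 0)^*`. -/
theorem exists_dual_comparison [IsLocalRing R] {M N : Type u} [AddCommGroup M] [Module R M]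
    [AddCommGroup N] [Module R N] {ε : F 0 →ₗ[R] M} {εG : G 0 →ₗ[R] N}
    (hF : IsMinimalFreeResolution d ε) (hG : IsMinimalFreeResolution dG εG) {s : ℕ}
    (hs : ∀ t < s, coboundaries d t = cocycles d t) (e₀ : G 0 ≃ₗ[R] Module.Dual R (F s))
    (he₀ : (LinearMap.range (dG 0)).map e₀.toLinearMap = coboundaries d s) :
    ∃ e : ∀ i j : ℕ, i + j = s → (G i ≃ₗ[R] Module.Dual R (F j)),
      (∀ i j h, (LinearMap.range (dG i)).map (e i j h).toLinearMap = coboundaries d j) ∧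
      ∀ (i j : ℕ) (h : i + (j + 1) = s) (h' : (i + 1) + j = s) (x : G (i + 1)),
        e i (j + 1) h (dG i x) = (d j).dualMap (e (i + 1) j h' x) := by
  -- The recursion carries the matching of images, which is what allows the next isomorphism to be
  -- lifted.
  let T (i : ℕ) : Type u := ∀ j, i + j = s → {e : G i ≃ₗ[R] Module.Dual R (F j) //
    (LinearMap.range (dG i)).map e.toLinearMap = coboundaries d j}
  have base : T 0 := fun j h => by
    obtain rfl : s = j := by omega
    exact ⟨e₀, he₀⟩
  have step (i : ℕ) (p : T i) : ∃ q : T (i + 1), ∀ (j : ℕ) (h : i + (j + 1) = s)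
      (h' : (i + 1) + j = s) (x : G (i + 1)),
        (p (j + 1) h).1 (dG i x) = (d j).dualMap ((q j h').1 x) := by
    have aux (j : ℕ) (h' : (i + 1) + j = s) : ∃ e : {e : G (i + 1) ≃ₗ[R] Module.Dual R (F j) //
        (LinearMap.range (dG (i + 1))).map e.toLinearMap = coboundaries d j},
        ∀ (h : i + (j + 1) = s) (x : G (i + 1)),
          (p (j + 1) h).1 (dG i x) = (d j).dualMap (e.1 x) := by
      have h : i + (j + 1) = s := by omega
      have := hG.free
      have := hG.finite
      have := hF.free
      have := hF.finite
      have hcob : coboundaries d j = LinearMap.ker (d j).dualMap := hs j (by omega)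
      obtain ⟨e, he⟩ := exists_equiv_lift (dG i) (d j).dualMap (p (j + 1) h).1 (p (j + 1) h).2
        (hG.ker_le i) (hcob.symm.trans_le (hF.coboundaries_le j))
      refine ⟨⟨e, ?_⟩, fun _ x => (he x).symm⟩
      rw [hcob, ← map_ker_of_comp_eq he, (hG.exact_succ i).linearMap_ker_eq]
    choose q hq using aux
    exact ⟨q, fun j h h' => hq j h' h⟩
  choose next hnext using step
  let e (i : ℕ) : T i := Nat.rec base next i
  exact ⟨fun i j h => (e i j h).1, fun i j h => (e i j h).2, fun i j h h' => hnext i (e i) j h h'⟩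

variable {s : ℕ}

/-- Degree `i + 1` of `G^*` is degree `s - i - 1` of `F`, positive by `hi`, where `F` is exact. -/
theorem coboundaries_succ_eq_cocycles_of_equiv (hd : ∀ n, Function.Exact (d (n + 1)) (d n))
    (hdG : ∀ n, Function.Exact (dG (n + 1)) (dG n))
    (e : ∀ i j : ℕ, i + j = s → (F j ≃ₗ[R] Module.Dual R (G i)))
    (he : ∀ (i j : ℕ) (h : i + (j + 1) = s) (h' : (i + 1) + j = s) (z : F (j + 1)),
      e (i + 1) j h' (d j z) = (dG i).dualMap (e i (j + 1) h z)) {i : ℕ} (hi : i + 1 < s) :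
    coboundaries dG (i + 1) = cocycles dG (i + 1) := by
  refine le_antisymm (coboundaries_le_cocycles hdG _) fun f hf => ?_
  obtain ⟨j, rfl⟩ : ∃ j, s = i + 1 + (j + 1) := ⟨s - i - 2, by omega⟩
  obtain ⟨z, rfl⟩ := (e (i + 1) (j + 1) rfl).surjective f
  have hz : e (i + 1 + 1) j (by omega) (d j z) = 0 := (he (i + 1) j rfl (by omega) z).trans hf
  obtain ⟨w, rfl⟩ := (hd j z).1 ((LinearEquiv.map_eq_zero_iff _).1 hz)
  exact ⟨e i (j + 2) (by omega) w, (he i (j + 1) (by omega) rfl w).symm⟩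

theorem coboundaries_zero_eq_cocycles_of_equiv (hd : ∀ n, Function.Exact (d (n + 1)) (d n))
    (e : ∀ i j : ℕ, i + j = s → (F j ≃ₗ[R] Module.Dual R (G i)))
    (he : ∀ (i j : ℕ) (h : i + (j + 1) = s) (h' : (i + 1) + j = s) (z : F (j + 1)),
      e (i + 1) j h' (d j z) = (dG i).dualMap (e i (j + 1) h z))
    (hs : 0 < s) (hsub : Subsingleton (F (s + 1))) :
    coboundaries dG 0 = cocycles dG 0 := by
  refine le_antisymm bot_le fun f hf => ?_
  obtain ⟨j, rfl⟩ : ∃ j, s = j + 1 := ⟨s - 1, by omega⟩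
  obtain ⟨z, rfl⟩ := (e 0 (j + 1) (by omega)).surjective f
  have hz : e 1 j (by omega) (d j z) = 0 := (he 0 j (by omega) (by omega) z).trans hf
  obtain ⟨w, rfl⟩ := (hd j z).1 ((LinearEquiv.map_eq_zero_iff _).1 hz)
  rw [Subsingleton.elim w 0, map_zero, map_zero]
  exact zero_mem _

/-- Identifies the cokernel of `d 0` with the cokernel at the top of `G^*`. For `s = 0` both
submodules vanish. -/
theorem map_range_eq_coboundaries_of_equiv
    (e : ∀ i j : ℕ, i + j = s → (F j ≃ₗ[R] Module.Dual R (G i)))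
    (he : ∀ (i j : ℕ) (h : i + (j + 1) = s) (h' : (i + 1) + j = s) (z : F (j + 1)),
      e (i + 1) j h' (d j z) = (dG i).dualMap (e i (j + 1) h z))
    (hsub : Subsingleton (F (s + 1))) :
    (LinearMap.range (d 0)).map (e s 0 rfl).toLinearMap = coboundaries dG s := by
  cases s with
  | zero =>
    rw [LinearMap.range_eq_bot.2 (Subsingleton.elim _ _), Submodule.map_bot]
    rfl
  | succ i => exact map_range_of_comp_eq (e := e i 1 rfl) (he i 0 rfl rfl)

end Comparison

/-! ### Grade, total self-duality and dual syzygies. -/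

section Main

variable {R : Type u} [CommRing R] {M : Type u} [AddCommGroup M] [Module R M]

theorem grade_eq {g : ℕ} (h : Nontrivial (ExtRing R M g))
    (h' : ∀ i < g, Subsingleton (ExtRing R M i)) : grade R M = (g : ℕ∞) := by
  refine le_antisymm (sInf_le ⟨g, rfl, h⟩) (le_sInf ?_)
  rintro _ ⟨i, rfl, hi⟩
  refine Nat.cast_le.2 (not_lt.1 fun hlt => ?_)
  exact not_subsingleton_iff_nontrivial.2 hi (h' i hlt)

theorem nontrivial_extRing_of_grade_eq {g : ℕ} (h : grade R M = (g : ℕ∞)) :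
    Nontrivial (ExtRing R M g) := by
  have hne : {n : ℕ∞ | ∃ i : ℕ, n = (i : ℕ∞) ∧ Nontrivial (ExtRing R M i)}.Nonempty := by
    by_contra hne
    rw [grade, Set.not_nonempty_iff_eq_empty.1 hne, sInf_empty] at h
    exact ENat.top_ne_natCast g h
  obtain ⟨i, hi, hnt⟩ := csInf_mem hne
  obtain rfl : g = i := by exact_mod_cast h.symm.trans hi
  exact hnt

theorem subsingleton_extRing_of_lt_grade {g i : ℕ} (h : grade R M = (g : ℕ∞)) (hi : i < g) :
    Subsingleton (ExtRing R M i) := by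
  by_contra hnt
  have : grade R M ≤ i := sInf_le ⟨i, rfl, not_subsingleton_iff_nontrivial.1 hnt⟩
  rw [h, Nat.cast_le] at this
  omega

variable {F : ℕ → Type u} [∀ n, AddCommGroup (F n)] [∀ n, Module R (F n)]
  {d : ∀ n, F (n + 1) →ₗ[R] F n}

theorem cocycles_eq_top {n : ℕ} (h : Subsingleton (F (n + 1))) : cocycles d n = ⊤ :=
  eq_top_iff.2 fun _ _ => Subsingleton.elim _ _

/-- In a self-dual resolution the dual of a syzygy is a syzygy. -/
theorem nonempty_dual_syzygy_equiv (hd : ∀ n, Function.Exact (d (n + 1)) (d n)) {r : ℕ}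
    (e : ∀ i j : ℕ, i + j = r → (F i ≃ₗ[R] Module.Dual R (F j)))
    (he : ∀ (i j : ℕ) (h : i + (j + 1) = r) (h' : (i + 1) + j = r) (x : F (i + 1)),
        e i (j + 1) h (d i x) = (d j).dualMap (e (i + 1) j h' x)) {i : ℕ} (hi : i < r) :
    Nonempty (Module.Dual R (Syzygy d i) ≃ₗ[R] Syzygy d (r + 1 - i)) := by
  obtain ⟨k, rfl⟩ : ∃ k, r = k + 1 + i := ⟨r - i - 1, by omega⟩
  rw [show k + 1 + i + 1 - i = k + 1 + 1 by omega]
  have hker : (LinearMap.ker (d k)).map (e (k + 1) i rfl).toLinearMap =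
      LinearMap.ker (d i).dualMap :=
    map_ker_of_comp_eq fun x => (he k i (by omega) rfl x).symm
  -- The chain is `(Ω^i M)^* = ker (d i)^* ≅ ker (d k) = im (d (k + 1)) ≅ Ω^{k+2} M`, with `k = r -
  -- i - 1`.
  exact ⟨(dualEquivKerDualMap (LinearMap.exact_iff.2 (Submodule.ker_mkQ (LinearMap.range (d i))))
    (Submodule.mkQ_surjective _)).trans <|
    ((e (k + 1) i rfl).submoduleMap _ |>.trans (LinearEquiv.ofEq _ _ hker)).symm.trans <|
    (LinearEquiv.ofEq _ _ (hd k).linearMap_ker_eq).trans <|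
    (d (k + 1)).quotKerEquivRange.symm.trans <|
    Submodule.quotEquivOfEq _ _ (hd (k + 1)).linearMap_ker_eq⟩

variable [IsLocalRing R] {ε : F 0 →ₗ[R] M}

theorem IsMinimalFreeResolution.subsingleton_extRing_iff (hF : IsMinimalFreeResolution d ε)
    (n : ℕ) : Subsingleton (ExtRing R M n) ↔ coboundaries d n = cocycles d n :=
  have := hF.free
  SelfDualResolution.subsingleton_extRing_iff hF.surjective hF.exact_zero hF.exact_succ n

/-- If `F n = 0` then `Ext^i_R(M, R) = 0` for `i ≥ n`. -/
theorem IsMinimalFreeResolution.lt_of_nontrivial_extRing (hF : IsMinimalFreeResolution d ε)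
    {n i : ℕ} (h : Subsingleton (F n)) (hi : Nontrivial (ExtRing R M i)) : i < n := by
  by_contra! hlt
  have := hF.subsingleton_of_ge hlt h
  refine not_subsingleton_iff_nontrivial.2 hi ((hF.subsingleton_extRing_iff i).2 ?_)
  exact SetLike.ext fun f => by simp [Subsingleton.elim f 0]

/-- The top cohomology of the dual complex maps onto `Ext^r_R(M, R)`. -/
theorem IsMinimalFreeResolution.exists_dual_map_extRing (hF : IsMinimalFreeResolution d ε)
    {r : ℕ} (hr : Subsingleton (F (r + 1))) :
    ∃ π : Module.Dual R (F r) →ₗ[R] ExtRing R M r, Function.Surjective π ∧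
      LinearMap.ker π = coboundaries d r := by
  have := hF.free
  obtain ⟨π, hπ, hker⟩ := exists_cocycles_map_extRing hF.surjective hF.exact_zero hF.exact_succ r
  have hmem (f : Module.Dual R (F r)) : f ∈ cocycles d r := (cocycles_eq_top hr).ge trivial
  refine ⟨π ∘ₗ LinearMap.id.codRestrict _ hmem, fun x => ?_, ?_⟩
  · obtain ⟨f, rfl⟩ := hπ x
    exact ⟨f.1, rfl⟩
  · ext f
    exact hker ⟨f, hmem f⟩

/-- The top cohomology becomes `F 0 ⧸ im (d 0) ≅ M`, which is nonzero, so the grade is exactly `r`.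
-/
theorem IsMinimalFreeResolution.isTotallySelfDual [Nontrivial M]
    (hF : IsMinimalFreeResolution d ε) {r : ℕ} (hr : Subsingleton (F (r + 1)))
    (hvan : ∀ i < r, coboundaries d i = cocycles d i) (e₀ : F 0 ≃ₗ[R] Module.Dual R (F r))
    (he₀ : (LinearMap.range (d 0)).map e₀.toLinearMap = coboundaries d r) :
    IsTotallySelfDual R M ∧ grade R M = (r : ℕ∞) := by
  obtain ⟨π, hπ, hker⟩ := hF.exists_dual_map_extRing hr
  have hker' : LinearMap.range (d 0) = LinearMap.ker (π ∘ₗ e₀.toLinearMap) := by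
    rw [LinearMap.ker_comp, hker, ← he₀]
    exact (Submodule.comap_map_eq_of_injective e₀.injective _).symm
  let φ : ExtRing R M r ≃ₗ[R] M :=
    (((Submodule.quotEquivOfEq _ _ hker').trans
      ((π ∘ₗ e₀.toLinearMap).quotKerEquivOfSurjective (hπ.comp e₀.surjective))).symm.trans
      (hF.exact_zero.linearEquivOfSurjective hF.surjective))
  have hnt : Nontrivial (ExtRing R M r) := φ.toEquiv.nontrivial
  have hlt (i : ℕ) (hi : i < r) : Subsingleton (ExtRing R M i) :=
    (hF.subsingleton_extRing_iff i).2 (hvan i hi)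
  have hgrade := grade_eq hnt hlt
  refine ⟨⟨‹_›, r, hgrade, ⟨φ⟩, fun i hi => ?_⟩, hgrade⟩
  by_contra hn
  have := hF.lt_of_nontrivial_extRing hr (not_subsingleton_iff_nontrivial.1 hn)
  exact hn (hlt i (by omega))

/-- A module with a self-dual minimal free resolution is totally self-dual, and the length of the
resolution is its grade. -/
theorem IsMinimalFreeResolution.isTotallySelfDual_of_equiv [Nontrivial M]
    (hF : IsMinimalFreeResolution d ε) {r : ℕ} (hr : ∀ i, r < i → Subsingleton (F i))
    (e : ∀ i j : ℕ, i + j = r → (F i ≃ₗ[R] Module.Dual R (F j)))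
    (he : ∀ (i j : ℕ) (h : i + (j + 1) = r) (h' : (i + 1) + j = r) (x : F (i + 1)),
        e i (j + 1) h (d i x) = (d j).dualMap (e (i + 1) j h' x)) :
    IsTotallySelfDual R M ∧ grade R M = (r : ℕ∞) := by
  let e' (i j : ℕ) (h : i + j = r) : F j ≃ₗ[R] Module.Dual R (F i) :=
    e j i ((Nat.add_comm j i).trans h)
  have he' (i j : ℕ) (h : i + (j + 1) = r) (h' : (i + 1) + j = r) (z : F (j + 1)) :
      e' (i + 1) j h' (d j z) = (d i).dualMap (e' i (j + 1) h z) :=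
    he j i (by omega) (by omega) z
  have hr' := hr (r + 1) (Nat.lt_succ_self r)
  refine hF.isTotallySelfDual hr' (fun i hi => ?_) (e' r 0 rfl)
    (map_range_eq_coboundaries_of_equiv e' he' hr')
  cases i with
  | zero => exact coboundaries_zero_eq_cocycles_of_equiv hF.exact_succ e' he' hi hr'
  | succ i => exact coboundaries_succ_eq_cocycles_of_equiv hF.exact_succ hF.exact_succ e' he' hi

theorem IsMinimalFreeResolution.isSelfDual [Nontrivial M] (hF : IsMinimalFreeResolution d ε)
    (hpd : pd R M ≠ ⊤) (h : IsTotallySelfDual R M) : IsSelfDual M d := by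
  obtain ⟨r, hnt, hr⟩ := hF.exists_length hpd
  obtain ⟨-, g, hg, ⟨φ⟩, hvan⟩ := h
  have := hF.free
  have := hF.finite
  obtain rfl : r = g := by
    -- If `Ext^r = 0`, every element of `(F r)^*` is a coboundary, so `(F r)^* = 𝔪 (F r)^*` and `F r
    -- = 0`.
    by_contra hne
    have hcob := (hF.subsingleton_extRing_iff r).1 (hvan r hne)
    rw [cocycles_eq_top hr] at hcob
    have := subsingleton_of_top_le_maximalIdeal_smul (hcob.symm.trans_le (hF.coboundaries_le r))
    refine not_subsingleton (F r) (Module.evalEquiv R (F r)).toEquiv.subsingleton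
  obtain ⟨π, hπ, hker⟩ := hF.exists_dual_map_extRing hr
  obtain ⟨e₀, he₀⟩ := exists_equiv_lift ε π φ.symm
    (by rw [LinearMap.range_eq_top.2 hF.surjective, LinearMap.range_eq_top.2 hπ,
      Submodule.map_top, LinearEquiv.range])
    hF.ker_augmentation_le (hker.trans_le (hF.coboundaries_le r))
  obtain ⟨e, -, he⟩ := exists_dual_comparison hF hF
    (fun t ht => (hF.subsingleton_extRing_iff t).1 (hvan t ht.ne)) e₀
    (by rw [← hker, ← map_ker_of_comp_eq he₀, hF.exact_zero.linearMap_ker_eq])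
  exact ⟨r, hF.pd_eq hnt hr, fun i hi => hF.subsingleton_of_ge hi hr, e, he⟩

/-- An isomorphism `(Ω^{s+1} M)^* ≅ Ω^n M` with `s + 1` below the grade identifies `F` from degree
`n` on with the dual of `F` up to degree `s`. -/
theorem IsMinimalFreeResolution.exists_equiv_of_dual_syzygy_equiv
    (hF : IsMinimalFreeResolution d ε) {s n : ℕ}
    (hs : ∀ t ≤ s + 1, coboundaries d t = cocycles d t)
    (φ : Module.Dual R (Syzygy d (s + 1)) ≃ₗ[R] Syzygy d n) :
    ∃ e : ∀ i j : ℕ, i + j = s → (F (n + i) ≃ₗ[R] Module.Dual R (F j)),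
      (∀ i j h, (LinearMap.range (d (n + i))).map (e i j h).toLinearMap = coboundaries d j) ∧
      ∀ (i j : ℕ) (h : i + (j + 1) = s) (h' : (i + 1) + j = s) (x : F (n + i + 1)),
        e i (j + 1) h (d (n + i) x) = (d j).dualMap (e (i + 1) j h' x) := by
  have := hF.free
  have := hF.finite
  have hG := hF.shift n
  let ψ : LinearMap.ker (d (s + 1)).dualMap ≃ₗ[R] Syzygy d n :=
    (dualEquivKerDualMap (LinearMap.exact_iff.2 (Submodule.ker_mkQ (LinearMap.range (d (s + 1)))))
      (Submodule.mkQ_surjective _)).symm.trans φ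
  have hZ : LinearMap.range (d s).dualMap = LinearMap.ker (d (s + 1)).dualMap := hs (s + 1) le_rfl
  let δ : Module.Dual R (F s) →ₗ[R] LinearMap.ker (d (s + 1)).dualMap :=
    (d s).dualMap.codRestrict _ fun f => hZ.le ⟨f, rfl⟩
  have hδ : Function.Surjective δ := by
    rintro ⟨f, hf⟩
    obtain ⟨k, rfl⟩ := hZ.ge hf
    exact ⟨k, rfl⟩
  have hkerδ : LinearMap.ker δ = coboundaries d s :=
    (LinearMap.ker_codRestrict _ _ _).trans (hs s (Nat.le_succ s)).symm
  let p : Module.Dual R (F s) →ₗ[R] Syzygy d n := ψ.toLinearMap ∘ₗ δ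
  have hp : Function.Surjective p := ψ.surjective.comp hδ
  have hkerp : LinearMap.ker p = coboundaries d s := (LinearEquiv.ker_comp _ _).trans hkerδ
  obtain ⟨e₀, he₀⟩ := exists_equiv_lift (LinearMap.range (d n)).mkQ p (LinearEquiv.refl R _)
    (by rw [Submodule.range_mkQ, LinearMap.range_eq_top.2 hp, Submodule.map_top,
      LinearEquiv.range])
    ((Submodule.ker_mkQ _).trans_le (hF.minimal n)) (hkerp.trans_le (hF.coboundaries_le s))
  have he₀' : (LinearMap.range (d n)).map e₀.toLinearMap = coboundaries d s := by
    rw [← hkerp, ← map_ker_of_comp_eq he₀, Submodule.ker_mkQ]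
  exact exists_dual_comparison hF hG (fun t ht => hs t (by omega)) e₀
    he₀'

theorem IsMinimalFreeResolution.of_dual_syzygy_equiv [Nontrivial M]
    (hF : IsMinimalFreeResolution d ε) {g : ℕ} (hg : grade R M = (g : ℕ∞)) {m n : ℕ} (hm : m < g)
    (hn : n < g) (φ : Module.Dual R (Syzygy d m) ≃ₗ[R] Syzygy d n) :
    2 ≤ m ∧ 2 ≤ n ∧ pd R M = ((g : ℕ∞) : WithBot ℕ∞) ∧ g = m + n - 1 ∧ IsSelfDual M d := by
  have hvan (i : ℕ) (hi : i < g) : coboundaries d i = cocycles d i :=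
    (hF.subsingleton_extRing_iff i).1 (subsingleton_extRing_of_lt_grade hg hi)
  have hgnt := nontrivial_extRing_of_grade_eq hg
  have := hF.free
  have := hF.finite
  rcases m with _ | s
  -- For `m = 0`, `M^* = 0` forces `Ω^n M = 0`, hence `F n = 0`, contradicting `Ext^g ≠ 0` with `g >
  -- n`.
  · have hbot : LinearMap.ker (d 0).dualMap = ⊥ := (hvan 0 hm).symm
    have hsub : Subsingleton (Module.Dual R (Syzygy d 0)) := by
      rw [(dualEquivKerDualMap (LinearMap.exact_iff.2 (Submodule.ker_mkQ (LinearMap.range (d 0))))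
        (Submodule.mkQ_surjective _)).toEquiv.subsingleton_congr, hbot]
      infer_instance
    have hn' : Subsingleton (Syzygy d n) := φ.symm.toEquiv.subsingleton
    have := hF.lt_of_nontrivial_extRing (hF.subsingleton_of_range_eq_top
      (Submodule.Quotient.subsingleton_iff.1 hn')) hgnt
    omega
  obtain ⟨e, hmap, he⟩ :=
    hF.exists_equiv_of_dual_syzygy_equiv (fun t ht => hvan t (by omega)) φ
  have hend : Subsingleton (F (n + s + 1)) := by
    have h0 : LinearMap.range (d (n + s)) = ⊥ :=
      Submodule.map_injective_of_injective (e s 0 rfl).injective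
        ((hmap s 0 rfl).trans (Submodule.map_bot _).symm)
    refine hF.subsingleton_of_range_eq_top (eq_top_iff.2 fun x _ => ?_)
    exact (hF.exact_succ (n + s) x).1
      (LinearMap.congr_fun (LinearMap.range_eq_bot.1 h0) x)
  have hgle := hF.lt_of_nontrivial_extRing hend hgnt
  -- Dualize the comparison, using that finite free modules are reflexive.
  let e' (i j : ℕ) (h : i + j = s) : F j ≃ₗ[R] Module.Dual R (F (n + i)) :=
    (Module.evalEquiv R (F j)).trans (e i j h).dualMap
  have he' (i j : ℕ) (h : i + (j + 1) = s) (h' : (i + 1) + j = s) (z : F (j + 1)) :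
      e' (i + 1) j h' (d j z) = (d (n + i)).dualMap (e' i (j + 1) h z) := by
    ext y
    exact (LinearMap.congr_fun (he i j h h' y) z).symm
  have hnt : Nontrivial (F (n + s)) := by
    by_contra hsub
    rw [not_nontrivial_iff_subsingleton] at hsub
    have := hF.nontrivial_zero
    exact not_subsingleton (F 0) (e' s 0 rfl).toEquiv.subsingleton
  have hG := hF.shift n
  -- `n < g ≤ n + s` gives `s ≥ 1`, that is `m ≥ 2`. Later `m = s + 1 < g = n + s` gives `n ≥ 2`.
  obtain ⟨k, rfl⟩ : ∃ k, s = k + 1 := ⟨s - 1, by omega⟩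
  have hmap' : (LinearMap.range (d 0)).map (e' (k + 1) 0 rfl).toLinearMap =
      coboundaries d (n + (k + 1)) :=
    map_range_of_comp_eq (e := e' k 1 rfl) (he' k 0 rfl rfl)
  obtain ⟨htsd, hgrade⟩ := hF.isTotallySelfDual hend (fun i hi => by
    rcases lt_or_ge i g with hig | hig
    · exact hvan i hig
    · obtain ⟨i, rfl⟩ : ∃ j, i = n + j + 1 := ⟨i - n - 1, by omega⟩
      exact coboundaries_succ_eq_cocycles_of_equiv hF.exact_succ hG.exact_succ e' he' (by omega))
    (e' (k + 1) 0 rfl) hmap'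
  obtain rfl : g = n + (k + 1) := by exact_mod_cast hg.symm.trans hgrade
  have hpd := hF.pd_eq hnt hend
  refine ⟨by omega, by omega, hpd, by omega, hF.isSelfDual (fun htop => ?_) htsd⟩
  rw [hpd] at htop
  exact ENat.natCast_ne_top _ (WithBot.coe_injective htop)

end Main

end SelfDualResolution

theorem theorem1p1 {R : Type u} [CommRing R] [IsNoetherianRing R] [IsLocalRing R]
    {M : Type u} [AddCommGroup M] [Module R M] [Module.Finite R M] [Nontrivial M]
    (g : ℕ) (hg : SelfDualResolution.grade R M = (g : ℕ∞))
    {F : ℕ → Type u} [∀ n, AddCommGroup (F n)] [∀ n, Module R (F n)]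
    (d : ∀ n, F (n + 1) →ₗ[R] F n) (ε : F 0 →ₗ[R] M)
    (hF : SelfDualResolution.IsMinimalFreeResolution d ε) :
    (SelfDualResolution.pd R M ≠ ⊤ →
      (SelfDualResolution.IsSelfDual M d ↔ SelfDualResolution.IsTotallySelfDual R M) ∧
      (SelfDualResolution.IsSelfDual M d → ∀ i : ℕ, i < g →
        Nonempty (Module.Dual R (SelfDualResolution.Syzygy d i) ≃ₗ[R]
          SelfDualResolution.Syzygy d (g + 1 - i)))) ∧
    (∀ m n : ℕ, m < g → n < g →
      Nonempty (Module.Dual R (SelfDualResolution.Syzygy d m) ≃ₗ[R]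
        SelfDualResolution.Syzygy d n) →
      2 ≤ m ∧ 2 ≤ n ∧
        SelfDualResolution.pd R M = ((g : ℕ∞) : WithBot ℕ∞) ∧
        g = m + n - 1 ∧
        SelfDualResolution.IsSelfDual M d) := by
  refine ⟨fun hpd => ⟨⟨fun h => ?_, hF.isSelfDual hpd⟩, fun h i hi => ?_⟩,
    fun m n hm hn ⟨φ⟩ => hF.of_dual_syzygy_equiv hg hm hn φ⟩
  · obtain ⟨r, -, hr, e, he⟩ := h
    exact (hF.isTotallySelfDual_of_equiv hr e he).1
  · obtain ⟨r, -, hr, e, he⟩ := h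
    obtain rfl : g = r := by
      exact_mod_cast hg.symm.trans (hF.isTotallySelfDual_of_equiv hr e he).2
    exact SelfDualResolution.nonempty_dual_syzygy_equiv hF.exact_succ e he hi
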